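/- Let $r\ge 2$ and $d\ge 0$, let $T\subset\mathbb{R}$ be a nonempty open interval and let $Q$ be a connected, paracompact, Hausdorff $d$-dimensional manifold without boundary of class $C^{r+1}$. Let $a_t$ be a positive definite metric, $b_t$ a 1-form field and $V(t,\cdot)$ a function on $Q$, all possibly depending on the time $t\in T$ and all of class $C^r$ jointly in $(t,q)\in T\times Q$, and let $$L(t,q,v)=\tfrac12\, a_t(v,v)+b_t(v)-V(t,q),\qquad t\in T,\ q\in Q,\ v\in T_qQ,$$ be the corresponding Lagrangian. Consider the spacetime $M=T\times Q\times\mathbb{R}$, with points $(t,q,y)$, Lorentzian metric $$g=a_t-dt\otimes(dy-b_t)-(dy-b_t)\otimes dt-2V\,dt^2,$$ of signature $(-,+,\dots,+)$, and time orientation given by the timelike vector field $W=\partial_t-(V-\tfrac12)\,\partial_y$. A tangent vector $u$ is future directed timelike if $g(u,u)<0$ and $g(u,W)<0$. For $x,z\in M$ write $z\in I^+(x)$, equivalently $x\in I^-(z)$, if there is a piecewise $C^1$ curve from $x$ to $z$ with future directed timelike velocity (one-sided velocities at the corners and at the endpoints). Theorem. If the Lagrangian does not depend on time, that is $L(t,q,v)=L(s,q,v)$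 for all $t,s\in T$, $q\in Q$, $v\in T_qQ$, then $(M,g)$ is reflective, both past and future: for all $x,z\in M$, $$z\in\overline{I^+(x)}\implies x\in\overline{I^-(z)}\quad\text{(past reflectivity)},\qquad x\in\overline{I^-(z)}\implies z\in\overline{I^+(x)}\quad\text{(future reflectivity)}.$$ -/

import Mathlib

open Set Topology
open scoped Manifold ContDiff

noncomputable section

/-! ## Chronology of a time-oriented manifold with a field of bilinear forms -/

section Chronology

variable {E : Type*} [NormedAddCommGroup E] [NormedSpace ℝ E]
  {H : Type*} [TopologicalSpace H] (J : ModelWithCorners ℝ E H)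
  {M : Type*} [TopologicalSpace M] [ChartedSpace H M]

/-- `v ∈ T_x M` is timelike and future directed, for the metric `g` of signature `(-,+,…,+)` and the
time orientation given by the timelike vector field `W`. -/
def IsFutureTimelike (g : ∀ x : M, TangentSpace J x →L[ℝ] TangentSpace J x →L[ℝ] ℝ)
    (W : ∀ x : M, TangentSpace J x) (x : M) (v : TangentSpace J x) : Prop :=
  g x v v < 0 ∧ g x v (W x) < 0

/-- There is a `C^1` future directed timelike curve `γ : [a, b] → M` from `x` to `y`. At the
endpoints of `[a, b]` the velocity is the one-sided derivative. -/
def TimelikeArc (g : ∀ x : M, TangentSpace J x →L[ℝ] TangentSpace J x →L[ℝ] ℝ)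
    (W : ∀ x : M, TangentSpace J x) (x y : M) : Prop :=
  ∃ (a b : ℝ) (γ : ℝ → M), a < b ∧ γ a = x ∧ γ b = y ∧
    ContMDiffOn 𝓘(ℝ, ℝ) J 1 γ (Icc a b) ∧
    ∀ s ∈ Icc a b,
      IsFutureTimelike J g W (γ s) (mfderivWithin 𝓘(ℝ, ℝ) J γ (Icc a b) s (1 : ℝ))

/-- The chronological relation `x ≪ y`: there is a piecewise `C^1` future directed timelike curve
from `x` to `y`, i.e. a concatenation of finitely many (at least one) `C^1` timelike curves. -/
def Chronological (g : ∀ x : M, TangentSpace J x →L[ℝ] TangentSpace J x →L[ℝ] ℝ)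
    (W : ∀ x : M, TangentSpace J x) (x y : M) : Prop :=
  Relation.TransGen (TimelikeArc J g W) x y

/-- The chronological future `I⁺(x)`. -/
def chronFuture (g : ∀ x : M, TangentSpace J x →L[ℝ] TangentSpace J x →L[ℝ] ℝ)
    (W : ∀ x : M, TangentSpace J x) (x : M) : Set M :=
  {y | Chronological J g W x y}

/-- The chronological past `I⁻(y)`. -/
def chronPast (g : ∀ x : M, TangentSpace J x →L[ℝ] TangentSpace J x →L[ℝ] ℝ)
    (W : ∀ x : M, TangentSpace J x) (y : M) : Set M :=
  {x | Chronological J g W x y}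

/-- Future reflectivity. -/
def FutureReflective (g : ∀ x : M, TangentSpace J x →L[ℝ] TangentSpace J x →L[ℝ] ℝ)
    (W : ∀ x : M, TangentSpace J x) : Prop :=
  ∀ x y : M, x ∈ closure (chronPast J g W y) → y ∈ closure (chronFuture J g W x)

/-- Past reflectivity. -/
def PastReflective (g : ∀ x : M, TangentSpace J x →L[ℝ] TangentSpace J x →L[ℝ] ℝ)
    (W : ∀ x : M, TangentSpace J x) : Prop :=
  ∀ x y : M, y ∈ closure (chronFuture J g W x) → x ∈ closure (chronPast J g W y)

/-- Reflectivity: both past and future reflectivity. -/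
def Reflective (g : ∀ x : M, TangentSpace J x →L[ℝ] TangentSpace J x →L[ℝ] ℝ)
    (W : ∀ x : M, TangentSpace J x) : Prop :=
  PastReflective J g W ∧ FutureReflective J g W

end Chronology

/-! ## Mechanical systems and their spacetimes -/

/-- The data of a classical mechanical system on the space `Q` over the time interval `T`: a time
dependent positive definite metric `a_t`, a time dependent 1-form field `b_t` and a potential
`V(t, q)`, all of class `C^r` jointly in `(t, q)`. -/
structure MechanicalSystem (r : ℕ∞ω) (d : ℕ) (T : TopologicalSpace.Opens ℝ) (Q : Type*)
    [TopologicalSpace Q] [ChartedSpace (EuclideanSpace ℝ (Fin d)) Q]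
    [IsManifold (𝓡 d) 1 Q] where
  /-- the time dependent metric -/
  a : T → ∀ q : Q, TangentSpace (𝓡 d) q →L[ℝ] TangentSpace (𝓡 d) q →L[ℝ] ℝ
  /-- the time dependent 1-form -/
  b : T → ∀ q : Q, TangentSpace (𝓡 d) q →L[ℝ] ℝ
  /-- the potential -/
  V : T → Q → ℝ
  a_symm : ∀ (t : T) (q : Q) (v w : TangentSpace (𝓡 d) q), a t q v w = a t q w v
  a_pos : ∀ (t : T) (q : Q) (v : TangentSpace (𝓡 d) q), v ≠ 0 → 0 < a t q v v
  contMDiff_a : ContMDiff (𝓘(ℝ, ℝ).prod (𝓡 d))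
    ((𝓡 d).prod 𝓘(ℝ, EuclideanSpace ℝ (Fin d) →L[ℝ] EuclideanSpace ℝ (Fin d) →L[ℝ] ℝ)) r
    (fun e : T × Q ↦ Bundle.TotalSpace.mk'
      (EuclideanSpace ℝ (Fin d) →L[ℝ] EuclideanSpace ℝ (Fin d) →L[ℝ] ℝ)
      (E := fun q : Q ↦ TangentSpace (𝓡 d) q →L[ℝ] TangentSpace (𝓡 d) q →L[ℝ] ℝ)
      e.2 (a e.1 e.2))
  contMDiff_b : ContMDiff (𝓘(ℝ, ℝ).prod (𝓡 d))
    ((𝓡 d).prod 𝓘(ℝ, EuclideanSpace ℝ (Fin d) →L[ℝ] ℝ)) r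
    (fun e : T × Q ↦ Bundle.TotalSpace.mk' (EuclideanSpace ℝ (Fin d) →L[ℝ] ℝ)
      (E := fun q : Q ↦ TangentSpace (𝓡 d) q →L[ℝ] ℝ)
      e.2 (b e.1 e.2))
  contMDiff_V : ContMDiff (𝓘(ℝ, ℝ).prod (𝓡 d)) 𝓘(ℝ, ℝ) r (fun e : T × Q ↦ V e.1 e.2)

/-- The model with corners of the `(d + 1) + 1`-dimensional manifold `T × Q × ℝ`. -/
abbrev spacetimeModel (d : ℕ) : ModelWithCorners ℝ (ℝ × EuclideanSpace ℝ (Fin d) × ℝ)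
    (ModelProd ℝ (ModelProd (EuclideanSpace ℝ (Fin d)) ℝ)) :=
  𝓘(ℝ, ℝ).prod ((𝓡 d).prod 𝓘(ℝ, ℝ))

namespace MechanicalSystem

variable {r : ℕ∞ω} {d : ℕ} {T : TopologicalSpace.Opens ℝ} {Q : Type*}
  [TopologicalSpace Q] [ChartedSpace (EuclideanSpace ℝ (Fin d)) Q] [IsManifold (𝓡 d) 1 Q]

/-- The Lagrangian `L(t, q, v) = ½ a_t(v, v) + b_t(v) - V(t, q)`. -/
def lagrangian (S : MechanicalSystem r d T Q) (t : T) (q : Q) (v : TangentSpace (𝓡 d) q) : ℝ :=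
  1 / 2 * S.a t q v v + S.b t q v - S.V t q

/-- The Lagrangian does not depend on time. -/
def IsAutonomous (S : MechanicalSystem r d T Q) : Prop :=
  ∀ (t s : T) (q : Q) (v : TangentSpace (𝓡 d) q), S.lagrangian t q v = S.lagrangian s q v

/-- The 1-form `dt` on `T × Q × ℝ`. Here and below, `T_{(t,q,y)}(T × Q × ℝ)` is `ℝ × T_q Q × ℝ`. -/
def dt (x : T × Q × ℝ) : TangentSpace (spacetimeModel d) x →L[ℝ] ℝ :=
  ContinuousLinearMap.fst ℝ ℝ (EuclideanSpace ℝ (Fin d) × ℝ)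

/-- The tangent map `T_{(t,q,y)}(T × Q × ℝ) → T_q Q` of the projection to `Q`. -/
def dq (x : T × Q × ℝ) :
    TangentSpace (spacetimeModel d) x →L[ℝ] TangentSpace (𝓡 d) x.2.1 :=
  (ContinuousLinearMap.fst ℝ (EuclideanSpace ℝ (Fin d)) ℝ).comp
    (ContinuousLinearMap.snd ℝ ℝ (EuclideanSpace ℝ (Fin d) × ℝ))

/-- The 1-form `dy` on `T × Q × ℝ`. -/
def dy (x : T × Q × ℝ) : TangentSpace (spacetimeModel d) x →L[ℝ] ℝ :=
  (ContinuousLinearMap.snd ℝ (EuclideanSpace ℝ (Fin d)) ℝ).comp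
    (ContinuousLinearMap.snd ℝ ℝ (EuclideanSpace ℝ (Fin d) × ℝ))

/-- The vector field `∂_t` on `T × Q × ℝ`. -/
def partialT (x : T × Q × ℝ) : TangentSpace (spacetimeModel d) x :=
  ((1, 0, 0) : ℝ × EuclideanSpace ℝ (Fin d) × ℝ)

/-- The vector field `∂_y` on `T × Q × ℝ`. -/
def partialY (x : T × Q × ℝ) : TangentSpace (spacetimeModel d) x :=
  ((0, 0, 1) : ℝ × EuclideanSpace ℝ (Fin d) × ℝ)

/-- The 1-form `dy - b_t` on `T × Q × ℝ`. -/
def connectionForm (S : MechanicalSystem r d T Q) (x : T × Q × ℝ) :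
    TangentSpace (spacetimeModel d) x →L[ℝ] ℝ :=
  dy x - (S.b x.1 x.2.1).comp (dq x)

/-- The spacetime metric `g = a_t - dt ⊗ (dy - b_t) - (dy - b_t) ⊗ dt - 2 V dt²` on
`M = T × Q × ℝ`. Here `a_t` stands for its pullback `(u, v) ↦ a_t(dq u, dq v)`,
and the tensor product of 1-forms `α ⊗ β` is `α.smulRight β : u ↦ α(u) β`. -/
def metric (S : MechanicalSystem r d T Q) (x : T × Q × ℝ) :
    TangentSpace (spacetimeModel d) x →L[ℝ] TangentSpace (spacetimeModel d) x →L[ℝ] ℝ :=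
  (ContinuousLinearMap.precomp ℝ (dq x)).comp ((S.a x.1 x.2.1).comp (dq x))
    - (dt x).smulRight (S.connectionForm x) - (S.connectionForm x).smulRight (dt x)
    - (2 * S.V x.1 x.2.1) • (dt x).smulRight (dt x)

/-- The vector field `W = ∂_t - (V - ½) ∂_y` giving the time orientation. -/
def timeOrientation (S : MechanicalSystem r d T Q) (x : T × Q × ℝ) :
    TangentSpace (spacetimeModel d) x :=
  partialT x - (S.V x.1 x.2.1 - 1 / 2) • partialY x

theorem metric_apply (S : MechanicalSystem r d T Q) (x : T × Q × ℝ)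
    (u v : TangentSpace (spacetimeModel d) x) :
    S.metric x u v = S.a x.1 x.2.1 (dq x u) (dq x v)
      - dt x u * (dy x v - S.b x.1 x.2.1 (dq x v))
      - (dy x u - S.b x.1 x.2.1 (dq x u)) * dt x v
      - 2 * S.V x.1 x.2.1 * (dt x u * dt x v) := by
  rfl

theorem metric_symm (S : MechanicalSystem r d T Q) (x : T × Q × ℝ)
    (u v : TangentSpace (spacetimeModel d) x) : S.metric x u v = S.metric x v u := by
  rw [metric_apply, metric_apply, S.a_symm]
  ring

theorem dt_timeOrientation (S : MechanicalSystem r d T Q) (x : T × Q × ℝ) :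
    dt x (S.timeOrientation x) = 1 := by
  change (1 : ℝ) - (S.V x.1 x.2.1 - 1 / 2) * 0 = 1
  ring

theorem dq_timeOrientation (S : MechanicalSystem r d T Q) (x : T × Q × ℝ) :
    dq x (S.timeOrientation x) = 0 := by
  change (0 : EuclideanSpace ℝ (Fin d)) - (S.V x.1 x.2.1 - 1 / 2) • (0 : EuclideanSpace ℝ (Fin d))
    = 0
  simp

theorem dy_timeOrientation (S : MechanicalSystem r d T Q) (x : T × Q × ℝ) :
    dy x (S.timeOrientation x) = 1 / 2 - S.V x.1 x.2.1 := by
  change (0 : ℝ) - (S.V x.1 x.2.1 - 1 / 2) * 1 = _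
  ring

/-- `W` is a unit timelike vector field. -/
theorem metric_timeOrientation (S : MechanicalSystem r d T Q) (x : T × Q × ℝ) :
    S.metric x (S.timeOrientation x) (S.timeOrientation x) = -1 := by
  simp only [metric_apply, dt_timeOrientation, dq_timeOrientation, dy_timeOrientation, map_zero]
  ring

/-- The metric is positive definite on the orthogonal complement of `W`; hence it has signature
`(-,+,…,+)`. -/
theorem metric_pos_of_orthogonal (S : MechanicalSystem r d T Q) (x : T × Q × ℝ)
    (u : TangentSpace (spacetimeModel d) x) (hu : u ≠ 0)
    (h : S.metric x u (S.timeOrientation x) = 0) : 0 < S.metric x u u := by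
  simp only [metric_apply, dt_timeOrientation, dq_timeOrientation, dy_timeOrientation,
    map_zero] at h
  have h2 : S.metric x u u = S.a x.1 x.2.1 (dq x u) (dq x u) + dt x u ^ 2 := by
    rw [metric_apply]
    linear_combination (2 * dt x u) * h
  rw [h2]
  by_cases hq : dq x u = 0
  · have ht : dt x u ≠ 0 := by
      intro ht
      apply hu
      simp only [ht, hq, map_zero] at h
      have hy : dy x u = 0 := by linarith
      exact Prod.ext ht (Prod.ext hq hy)
    rw [hq]
    simp only [map_zero, zero_add]
    positivity
  · have := S.a_pos x.1 x.2.1 _ hq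
    positivity

end MechanicalSystem

end

/-! For a time-independent Lagrangian the coefficients of `g` depend on `q` only, so for every real
`c` translation along `∂_t + c ∂_y` is an isometry as long as times stay in `T`. It carries a
chronological relation to one between the translated endpoints once these have times in `T`: `dt` is
positive on future timelike vectors, so intermediate times lie between the end times, and `T` is an
interval (`Chronological.translate`). The field `∂_t + c ∂_y` is timelike over `q` exactly when `c >
-V(q)`. With such a `c` at `z`, and `z'` a small future translate of `z`, all points close enough to
`z` lie in the past of `z'` (`eventually_timelikeArc`). If `z` is in the closure of the future of
`x`, then some `w` satisfies `x ≪ w ≪ z'`; translating back puts a past translate of `x` in the past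
of `z`, and letting the shift tend to zero gives past reflectivity. Future reflectivity is the
mirror image, with `c` chosen at `x`. -/

section OpensReal

variable {T : TopologicalSpace.Opens ℝ}

/-! ### Calculus of curves in an open subset of the line. -/

theorem hasMFDerivWithinAt_toSpanSingleton_iff {f : ℝ → ℝ} {s : Set ℝ} {x τ : ℝ} :
    HasMFDerivWithinAt 𝓘(ℝ, ℝ) 𝓘(ℝ, ℝ) f s x (ContinuousLinearMap.toSpanSingleton ℝ τ) ↔
      HasDerivWithinAt f τ s x := by
  rw [hasDerivWithinAt_iff_hasFDerivWithinAt]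
  exact hasMFDerivWithinAt_iff_hasFDerivWithinAt

theorem hasMFDerivWithinAt_opens_iff {f : ℝ → T} {s : Set ℝ} {x τ : ℝ} :
    HasMFDerivWithinAt 𝓘(ℝ, ℝ) 𝓘(ℝ, ℝ) f s x (ContinuousLinearMap.toSpanSingleton ℝ τ) ↔
      HasDerivWithinAt (fun σ ↦ (f σ : ℝ)) τ s x := by
  rw [← hasMFDerivWithinAt_toSpanSingleton_iff]
  exact and_congr_left' Topology.IsInducing.subtypeVal.continuousWithinAt_iff

theorem contMDiffOn_opens_iff_contDiffOn {f : ℝ → T} {s : Set ℝ} {n : ℕ∞ω} :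
    ContMDiffOn 𝓘(ℝ, ℝ) 𝓘(ℝ, ℝ) n f s ↔ ContDiffOn ℝ n (fun σ ↦ (f σ : ℝ)) s := by
  rw [← contMDiffOn_iff_contDiffOn]
  exact forall₂_congr fun x _ ↦ (ChartedSpace.liftPropWithinAt_subtypeVal_comp_iff ..).symm

end OpensReal

/-! ### Straight segments in a chart and their velocities. -/

section Segment

variable {d : ℕ} {Q : Type*} [TopologicalSpace Q] [ChartedSpace (EuclideanSpace ℝ (Fin d)) Q]

/-- The velocity of the straight segment from `p.1` to `p.2`, in the chart at `q₀`. -/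
noncomputable def segmentVelocity (q₀ : Q) (p : Q × Q) (s : ℝ) : TangentBundle (𝓡 d) Q :=
  tangentMapWithin 𝓘(ℝ, EuclideanSpace ℝ (Fin d)) (𝓡 d) (extChartAt (𝓡 d) q₀).symm
    (extChartAt (𝓡 d) q₀).target
    ((tangentBundleModelSpaceHomeomorph 𝓘(ℝ, EuclideanSpace ℝ (Fin d))).symm
      (AffineMap.lineMap (extChartAt (𝓡 d) q₀ p.1) (extChartAt (𝓡 d) q₀ p.2) s,
        extChartAt (𝓡 d) q₀ p.2 - extChartAt (𝓡 d) q₀ p.1))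

theorem continuousAt_lineMap_extChartAt (q₀ : Q) (s : ℝ) :
    ContinuousAt (fun p : (Q × Q) × ℝ ↦ AffineMap.lineMap
      (extChartAt (𝓡 d) q₀ p.1.1) (extChartAt (𝓡 d) q₀ p.1.2) p.2) ((q₀, q₀), s) := by
  have h := continuousAt_extChartAt (I := 𝓡 d) q₀
  have h1 : ContinuousAt (fun p : (Q × Q) × ℝ ↦ extChartAt (𝓡 d) q₀ p.1.1) ((q₀, q₀), s) :=
    h.comp' (f := fun p : (Q × Q) × ℝ ↦ p.1.1) (by fun_prop)
  have h2 : ContinuousAt (fun p : (Q × Q) × ℝ ↦ extChartAt (𝓡 d) q₀ p.1.2) ((q₀, q₀), s) :=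
    h.comp' (f := fun p : (Q × Q) × ℝ ↦ p.1.2) (by fun_prop)
  simp only [AffineMap.lineMap_apply_module]
  fun_prop

theorem segmentVelocity_self (q₀ : Q) (s : ℝ) :
    segmentVelocity (d := d) q₀ (q₀, q₀) s = ⟨q₀, 0⟩ := by
  have : ∀ x : EuclideanSpace ℝ (Fin d), (extChartAt (𝓡 d) q₀).symm x = q₀ →
    tangentMapWithin 𝓘(ℝ, EuclideanSpace ℝ (Fin d)) (𝓡 d) (extChartAt (𝓡 d) q₀).symm
      (extChartAt (𝓡 d) q₀).target ⟨x, 0⟩ = ⟨q₀, 0⟩ := by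
    rintro x hx
    simp only [tangentMapWithin, map_zero]
    rw [hx]
  rw [← this (extChartAt (𝓡 d) q₀ q₀) (extChartAt_to_inv q₀)]
  simp only [segmentVelocity, AffineMap.lineMap_same_apply, sub_self]
  rfl

end Segment

/-! ### Timelike vectors and arcs in components. -/

namespace MechanicalSystem

variable {r : ℕ∞ω} {d : ℕ} {T : TopologicalSpace.Opens ℝ} {Q : Type*}
  [TopologicalSpace Q] [ChartedSpace (EuclideanSpace ℝ (Fin d)) Q] [IsManifold (𝓡 d) 1 Q]

/-- A vector is future directed timelike iff its components `(τ, v, η)` in `ℝ × T_q Q × ℝ`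
satisfy `τ > 0` and `τ η > ½ a(v, v) + τ b(v) - V τ²`. -/
theorem isFutureTimelike_iff (S : MechanicalSystem r d T Q) (x : T × Q × ℝ)
    (u : TangentSpace (spacetimeModel d) x) :
    IsFutureTimelike (spacetimeModel d) S.metric S.timeOrientation x u ↔
      0 < dt x u ∧ S.a x.1 x.2.1 (dq x u) (dq x u)
        - 2 * dt x u * (dy x u - S.b x.1 x.2.1 (dq x u)) - 2 * S.V x.1 x.2.1 * dt x u ^ 2 < 0 := by
  unfold IsFutureTimelike
  simp only [metric_apply, dt_timeOrientation, dq_timeOrientation, dy_timeOrientation, map_zero]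
  have ha : 0 ≤ S.a x.1 x.2.1 (dq x u) (dq x u) := by
    by_cases h : dq x u = 0
    · simp [h]
    · exact (S.a_pos _ _ _ h).le
  generalize S.a x.1 x.2.1 (dq x u) (dq x u) = A at *
  generalize S.b x.1 x.2.1 (dq x u) = B at *
  generalize S.V x.1 x.2.1 = V at *
  generalize dt x u = τ at *
  generalize dy x u = η at *
  -- Here `g(u,u) = A - 2τ(η - B + Vτ)` and `g(u,W) = -τ/2 - (η - B + Vτ)`. Since `A ≥ 0`, the first
  -- being negative gives `τ` and `η - B + Vτ` the same strict sign; the second makes that sign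
  -- positive.
  constructor
  · rintro ⟨h1, h2⟩
    refine ⟨?_, by linarith⟩
    by_contra h
    have : 0 < -τ := by nlinarith
    nlinarith
  · rintro ⟨h1, h2⟩
    have : 0 < (η - B + V * τ) := by
      by_contra h
      nlinarith
    exact ⟨by linarith, by linarith⟩

/-- Timelike arcs in terms of their components in `T`, `Q` and `ℝ`. -/
theorem timelikeArc_iff (S : MechanicalSystem r d T Q) (x z : T × Q × ℝ) :
    TimelikeArc (spacetimeModel d) S.metric S.timeOrientation x z ↔
      ∃ (a b : ℝ) (t : ℝ → T) (q : ℝ → Q) (y : ℝ → ℝ) (τ : ℝ → ℝ)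
        (v : ∀ s, TangentSpace (𝓡 d) (q s)) (η : ℝ → ℝ),
        a < b ∧ (t a, q a, y a) = x ∧ (t b, q b, y b) = z ∧
        ContDiffOn ℝ 1 (fun s ↦ (t s : ℝ)) (Icc a b) ∧ ContMDiffOn 𝓘(ℝ, ℝ) (𝓡 d) 1 q (Icc a b) ∧
        ContDiffOn ℝ 1 y (Icc a b) ∧
        ∀ s ∈ Icc a b, HasDerivWithinAt (fun s ↦ (t s : ℝ)) (τ s) (Icc a b) s ∧
          HasMFDerivWithinAt 𝓘(ℝ, ℝ) (𝓡 d) q (Icc a b) s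
            (ContinuousLinearMap.toSpanSingleton ℝ (v s)) ∧
          HasDerivWithinAt y (η s) (Icc a b) s ∧ 0 < τ s ∧
          S.a (t s) (q s) (v s) (v s) - 2 * τ s * (η s - S.b (t s) (q s) (v s))
            - 2 * S.V (t s) (q s) * τ s ^ 2 < 0 := by
  constructor
  · rintro ⟨a, b, γ, hab, hx, hz, hγ, h⟩
    have key : ∀ s ∈ Icc a b, ∀ u : TangentSpace (spacetimeModel d) (γ s),
        u = mfderivWithin 𝓘(ℝ, ℝ) (spacetimeModel d) γ (Icc a b) s (1 : ℝ) →
        HasMFDerivWithinAt 𝓘(ℝ, ℝ) (spacetimeModel d) γ (Icc a b) s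
            (ContinuousLinearMap.toSpanSingleton ℝ u) := by
      rintro s hs u rfl
      have := ((hγ s hs).mdifferentiableWithinAt one_ne_zero).hasMFDerivWithinAt
      exact (congrArg (HasMFDerivWithinAt 𝓘(ℝ, ℝ) (spacetimeModel d) γ (Icc a b) s)
        (ContinuousLinearMap.toSpanSingleton_apply_map_one (R₁ := ℝ)
          (M₂ := ℝ × EuclideanSpace ℝ (Fin d) × ℝ) _)).mpr this
    refine ⟨a, b, fun s ↦ (γ s).1, fun s ↦ (γ s).2.1, fun s ↦ (γ s).2.2,
      fun s ↦ dt _ (mfderivWithin 𝓘(ℝ, ℝ) (spacetimeModel d) γ (Icc a b) s (1 : ℝ)),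
      fun s ↦ dq _ (mfderivWithin 𝓘(ℝ, ℝ) (spacetimeModel d) γ (Icc a b) s (1 : ℝ)),
      fun s ↦ dy _ (mfderivWithin 𝓘(ℝ, ℝ) (spacetimeModel d) γ (Icc a b) s (1 : ℝ)),
      hab, by simp [hx], by simp [hz],
      contMDiffOn_opens_iff_contDiffOn.1 (contMDiff_fst.comp_contMDiffOn hγ),
      contMDiff_fst.comp_contMDiffOn (contMDiff_snd.comp_contMDiffOn hγ),
      contMDiffOn_iff_contDiffOn.1
        (contMDiff_snd.comp_contMDiffOn (contMDiff_snd.comp_contMDiffOn hγ)), fun s hs ↦ ?_⟩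
    have h1 := key s hs _ rfl
    have h2 := (isFutureTimelike_iff S _ _).1 (h s hs)
    refine ⟨?_, ?_, ?_, h2.1, h2.2⟩
    · rw [← hasMFDerivWithinAt_opens_iff]
      convert! (hasMFDerivAt_fst _).comp_hasMFDerivWithinAt s h1
    · convert! (hasMFDerivAt_fst _).comp_hasMFDerivWithinAt s
        ((hasMFDerivAt_snd _).comp_hasMFDerivWithinAt s h1)
    · rw [← hasMFDerivWithinAt_toSpanSingleton_iff]
      convert! (hasMFDerivAt_snd _).comp_hasMFDerivWithinAt s
        ((hasMFDerivAt_snd _).comp_hasMFDerivWithinAt s h1)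
  · rintro ⟨a, b, t, q, y, τ, v, η, hab, rfl, rfl, ht, hq, hy, h⟩
    refine ⟨a, b, fun s ↦ (t s, q s, y s), hab, rfl, rfl,
      (contMDiffOn_opens_iff_contDiffOn.2 ht).prodMk
        (hq.prodMk (contMDiffOn_iff_contDiffOn.2 hy)), fun s hs ↦ ?_⟩
    obtain ⟨h1, h2, h3, h4, h5⟩ := h s hs
    rw [← hasMFDerivWithinAt_opens_iff] at h1
    rw [← hasMFDerivWithinAt_toSpanSingleton_iff] at h3
    have h6 := (h1.prodMk (h2.prodMk h3)).mfderivWithin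
      ((uniqueDiffOn_Icc hab).uniqueMDiffOn s hs)
    rw [isFutureTimelike_iff]
    have h7 : mfderivWithin 𝓘(ℝ, ℝ) (spacetimeModel d) (fun s ↦ (t s, q s, y s)) (Icc a b) s (1 : ℝ)
      = ((τ s, v s, η s) : ℝ × EuclideanSpace ℝ (Fin d) × ℝ) := by
      rw [h6]
      refine Prod.ext (one_smul ℝ (τ s)) (Prod.ext (one_smul ℝ (v s)) (one_smul ℝ (η s)))
    rw [h7]
    exact ⟨h4, h5⟩

/-! ### Time independence of the coefficients. -/

section Autonomous

variable {S : MechanicalSystem r d T Q}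

theorem IsAutonomous.V_eq (hS : S.IsAutonomous) (t s : T) (q : Q) : S.V t q = S.V s q := by
  have h := hS t s q 0
  simp only [lagrangian, map_zero] at h
  linarith

/-- `b` is the part of the Lagrangian that is odd in the velocity. -/
theorem IsAutonomous.b_eq (hS : S.IsAutonomous) (t s : T) (q : Q) (v : TangentSpace (𝓡 d) q) :
    S.b t q v = S.b s q v := by
  have h := hS t s q v
  have h' := hS t s q (-v)
  simp only [lagrangian, map_neg, neg_apply] at h h'
  linarith

/-- The diagonal is enough: only `a(v, v)` enters the timelike condition. -/
theorem IsAutonomous.a_eq (hS : S.IsAutonomous) (t s : T) (q : Q) (v : TangentSpace (𝓡 d) q) :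
    S.a t q v v = S.a s q v v := by
  have h := hS t s q v
  have hb := hS.b_eq t s q v
  have hV := hS.V_eq t s q
  simp only [lagrangian] at h
  linarith

end Autonomous

/-! ### Monotonicity of time and translations of arcs. -/

theorem time_lt_of_timelikeArc {S : MechanicalSystem r d T Q} {x z : T × Q × ℝ}
    (h : TimelikeArc (spacetimeModel d) S.metric S.timeOrientation x z) : x.1 < z.1 := by
  obtain ⟨a, b, t, q, y, τ, v, η, hab, rfl, rfl, ht, -, -, h⟩ := (S.timelikeArc_iff x z).1 h
  have : StrictMonoOn (fun s ↦ (t s : ℝ)) (Icc a b) := by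
    refine strictMonoOn_of_deriv_pos (convex_Icc a b) ht.continuousOn fun s hs ↦ ?_
    rw [interior_Icc] at hs
    obtain ⟨h1, -, -, h2, -⟩ := h s (Ioo_subset_Icc_self hs)
    rwa [(h1.hasDerivAt (Icc_mem_nhds hs.1 hs.2)).deriv]
  exact this (left_mem_Icc.2 hab.le) (right_mem_Icc.2 hab.le) hab

theorem time_lt_of_chronological {S : MechanicalSystem r d T Q} {x z : T × Q × ℝ}
    (h : Chronological (spacetimeModel d) S.metric S.timeOrientation x z) : x.1 < z.1 := by
  induction h with
  | single h => exact time_lt_of_timelikeArc h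
  | tail _ h ih => exact ih.trans (time_lt_of_timelikeArc h)

/-- Translations along a Killing field `∂_t + c ∂_y` preserve timelike arcs. -/
theorem TimelikeArc.translate {S : MechanicalSystem r d T Q} (hS : S.IsAutonomous)
    (hT : (T : Set ℝ).OrdConnected) {x z : T × Q × ℝ} {t₀ t₁ : T} {σ c : ℝ}
    (h₀ : (t₀ : ℝ) = x.1 + σ) (h₁ : (t₁ : ℝ) = z.1 + σ)
    (h : TimelikeArc (spacetimeModel d) S.metric S.timeOrientation x z) :
    TimelikeArc (spacetimeModel d) S.metric S.timeOrientation
      (t₀, x.2.1, x.2.2 + c) (t₁, z.2.1, z.2.2 + c) := by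
  obtain ⟨a, b, t, q, y, τ, v, η, hab, rfl, rfl, ht, hq, hy, h⟩ := (S.timelikeArc_iff x z).1 h
  have hmono : MonotoneOn (fun s ↦ (t s : ℝ)) (Icc a b) := by
    refine monotoneOn_of_deriv_nonneg (convex_Icc a b) ht.continuousOn ?_ ?_ <;>
    rw [interior_Icc] <;> intro s hs <;>
    obtain ⟨h1, -, -, h2, -⟩ := h s (Ioo_subset_Icc_self hs) <;>
    have h3 := h1.hasDerivAt (Icc_mem_nhds hs.1 hs.2)
    · exact h3.differentiableAt.differentiableWithinAt
    · exact h3.deriv ▸ h2.le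
  -- Time is monotone along the arc, so the shifted times lie between `t₀` and `t₁`, hence in the
  -- interval `T`.
  have hmem : ∀ s ∈ Icc a b, (t s : ℝ) + σ ∈ T := fun s hs ↦ by
    refine hT.out t₀.2 t₁.2 ⟨?_, ?_⟩
    · rw [h₀]
      exact add_le_add_left (hmono (left_mem_Icc.2 hab.le) hs hs.1) σ
    · rw [h₁]
      exact add_le_add_left (hmono hs (right_mem_Icc.2 hab.le) hs.2) σ
  classical
  -- The default `t₀` is never taken on `[a, b]`.
  let t' : ℝ → T := fun s ↦ if h : (t s : ℝ) + σ ∈ T then ⟨_, h⟩ else t₀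
  have ht' : ∀ s ∈ Icc a b, (t' s : ℝ) = t s + σ := fun s hs ↦ by simp [t', hmem s hs]
  refine (S.timelikeArc_iff _ _).2 ⟨a, b, t', q, fun s ↦ y s + c, τ, v, η, hab, ?_, ?_,
    (ht.add contDiffOn_const).congr ht', hq, hy.add contDiffOn_const, fun s hs ↦ ?_⟩
  · exact Prod.ext (Subtype.ext ((ht' a (left_mem_Icc.2 hab.le)).trans h₀.symm)) rfl
  · exact Prod.ext (Subtype.ext ((ht' b (right_mem_Icc.2 hab.le)).trans h₁.symm)) rfl
  · obtain ⟨h1, h2, h3, h4, h5⟩ := h s hs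
    refine ⟨(h1.add_const σ).congr ht' (ht' s hs), h2, h3.add_const c, h4, ?_⟩
    rwa [hS.a_eq (t' s) (t s), hS.b_eq (t' s) (t s), hS.V_eq (t' s) (t s)]

theorem Chronological.translate {S : MechanicalSystem r d T Q} (hS : S.IsAutonomous)
    (hT : (T : Set ℝ).OrdConnected) {x z : T × Q × ℝ} {t₀ t₁ : T} {σ c : ℝ}
    (h₀ : (t₀ : ℝ) = x.1 + σ) (h₁ : (t₁ : ℝ) = z.1 + σ)
    (h : Chronological (spacetimeModel d) S.metric S.timeOrientation x z) :
    Chronological (spacetimeModel d) S.metric S.timeOrientation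
      (t₀, x.2.1, x.2.2 + c) (t₁, z.2.1, z.2.2 + c) := by
  unfold Chronological at h
  induction h generalizing t₁ with
  | single h => exact .single (TimelikeArc.translate hS hT h₀ h₁ h)
  | @tail w z hxw hwz ih =>
    have h1 : (x.1 : ℝ) < w.1 := time_lt_of_chronological hxw
    have h2 : (w.1 : ℝ) < z.1 := time_lt_of_timelikeArc hwz
    have hw : (w.1 : ℝ) + σ ∈ T := hT.out t₀.2 t₁.2 ⟨by linarith, by linarith⟩
    exact .tail (ih (t₁ := ⟨_, hw⟩) rfl) (TimelikeArc.translate hS hT rfl h₁ hwz)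

/-! ### Continuity of the coefficients on the tangent bundle. -/

theorem continuous_b (S : MechanicalSystem r d T Q) :
    Continuous fun p : T × TangentBundle (𝓡 d) Q ↦ S.b p.1 p.2.proj p.2.2 := by
  have hb : ContMDiff (𝓘(ℝ, ℝ).prod (𝓡 d).tangent)
      ((𝓡 d).prod 𝓘(ℝ, EuclideanSpace ℝ (Fin d) →L[ℝ] ℝ)) 0
      (fun p : T × TangentBundle (𝓡 d) Q ↦
        Bundle.TotalSpace.mk' (EuclideanSpace ℝ (Fin d) →L[ℝ] ℝ)
          (E := fun q : Q ↦ TangentSpace (𝓡 d) q →L[ℝ] Bundle.Trivial Q ℝ q)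
          p.2.proj (S.b p.1 p.2.proj)) :=
    (S.contMDiff_b.of_le zero_le).comp
      (contMDiff_fst.prodMk ((Bundle.contMDiff_proj _).comp contMDiff_snd))
  have h := ContMDiff.clm_bundle_apply (n := 0) (F₁ := EuclideanSpace ℝ (Fin d)) (F₂ := ℝ)
    (E₂ := Bundle.Trivial Q ℝ)
    (b := fun p : T × TangentBundle (𝓡 d) Q ↦ p.2.proj) hb
    (v := fun p : T × TangentBundle (𝓡 d) Q ↦ p.2.2) contMDiff_snd
  have h2 : ContMDiff (𝓘(ℝ, ℝ).prod (𝓡 d).tangent) 𝓘(ℝ, ℝ) 0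
     fun p : T × TangentBundle (𝓡 d) Q ↦ S.b p.1 p.2.proj p.2.2 := fun p ↦
    ((Bundle.contMDiffAt_totalSpace ..).1 (h p)).2
  exact h2.continuous

theorem continuous_a (S : MechanicalSystem r d T Q) :
    Continuous fun p : T × TangentBundle (𝓡 d) Q ↦ S.a p.1 p.2.proj p.2.2 p.2.2 := by
  have ha : ContMDiff (𝓘(ℝ, ℝ).prod (𝓡 d).tangent)
      ((𝓡 d).prod 𝓘(ℝ, EuclideanSpace ℝ (Fin d) →L[ℝ] EuclideanSpace ℝ (Fin d) →L[ℝ] ℝ)) 0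
      (fun p : T × TangentBundle (𝓡 d) Q ↦
        Bundle.TotalSpace.mk' (EuclideanSpace ℝ (Fin d) →L[ℝ] EuclideanSpace ℝ (Fin d) →L[ℝ] ℝ)
          (E := fun q : Q ↦
            TangentSpace (𝓡 d) q →L[ℝ] TangentSpace (𝓡 d) q →L[ℝ] Bundle.Trivial Q ℝ q)
          p.2.proj (S.a p.1 p.2.proj)) :=
    (S.contMDiff_a.of_le zero_le).comp
      (contMDiff_fst.prodMk ((Bundle.contMDiff_proj _).comp contMDiff_snd))
  have h := ContMDiff.clm_bundle_apply₂ (n := 0) (F₁ := EuclideanSpace ℝ (Fin d))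
    (F₂ := EuclideanSpace ℝ (Fin d)) (F₃ := ℝ) (E₃ := Bundle.Trivial Q ℝ)
    (b := fun p : T × TangentBundle (𝓡 d) Q ↦ p.2.proj) ha
    (v := fun p : T × TangentBundle (𝓡 d) Q ↦ p.2.2)
    (w := fun p : T × TangentBundle (𝓡 d) Q ↦ p.2.2)
    contMDiff_snd contMDiff_snd
  have h2 : ContMDiff (𝓘(ℝ, ℝ).prod (𝓡 d).tangent) 𝓘(ℝ, ℝ) 0
     fun p : T × TangentBundle (𝓡 d) Q ↦ S.a p.1 p.2.proj p.2.2 p.2.2 := fun p ↦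
    ((Bundle.contMDiffAt_totalSpace ..).1 (h p)).2
  exact h2.continuous

theorem continuous_V (S : MechanicalSystem r d T Q) :
    Continuous fun p : T × Q ↦ S.V p.1 p.2 := S.contMDiff_V.continuous

/-- The quantity whose negativity means that the vector `τ ∂_t + v + η ∂_y` is timelike, at a time
`t` and as a function of `(v, τ, η)`. -/
noncomputable def normSq (S : MechanicalSystem r d T Q) (t : T)
    (p : TangentBundle (𝓡 d) Q × ℝ × ℝ) : ℝ :=
  S.a t p.1.proj p.1.2 p.1.2 - 2 * p.2.1 * (p.2.2 - S.b t p.1.proj p.1.2)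
    - 2 * S.V t p.1.proj * p.2.1 ^ 2

theorem continuous_normSq (S : MechanicalSystem r d T Q) (t : T) : Continuous (S.normSq t) := by
  have hp : Continuous fun p : TangentBundle (𝓡 d) Q × ℝ × ℝ ↦ (t, p.1) := by fun_prop
  have ha := S.continuous_a.comp hp
  have hb := S.continuous_b.comp hp
  have hV := S.continuous_V.comp
    (continuous_const.prodMk ((FiberBundle.continuous_proj _ _).comp continuous_fst) :
      Continuous fun p : TangentBundle (𝓡 d) Q × ℝ × ℝ ↦ (t, p.1.proj))
  simp only [Function.comp_def] at ha hb hV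
  unfold normSq
  fun_prop

theorem normSq_zero (S : MechanicalSystem r d T Q) (t : T) (q : Q) (τ η : ℝ) :
    S.normSq t (⟨q, 0⟩, τ, η) = -2 * τ * η - 2 * S.V t q * τ ^ 2 := by
  simp only [normSq, map_zero]
  ring

/-- The inverse chart is `C^1` on its open target, so its tangent map is continuous over that
target; at `(q₀, q₀)` the segment is constant at the image of `q₀`, which lies in it. -/
theorem continuousAt_segmentVelocity (q₀ : Q) (s : ℝ) :
    ContinuousAt (fun p : (Q × Q) × ℝ ↦ segmentVelocity (d := d) q₀ p.1 p.2) ((q₀, q₀), s) := by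
  have h := continuousAt_extChartAt (I := 𝓡 d) q₀
  have h1 : ContinuousAt (fun p : (Q × Q) × ℝ ↦ extChartAt (𝓡 d) q₀ p.1.1) ((q₀, q₀), s) :=
    h.comp' (f := fun p : (Q × Q) × ℝ ↦ p.1.1) (by fun_prop)
  have h2 : ContinuousAt (fun p : (Q × Q) × ℝ ↦ extChartAt (𝓡 d) q₀ p.1.2) ((q₀, q₀), s) :=
    h.comp' (f := fun p : (Q × Q) × ℝ ↦ p.1.2) (by fun_prop)
  have hU := isOpen_extChartAt_target (I := 𝓡 d) q₀
  have hc := (contMDiffOn_extChartAt_symm (I := 𝓡 d) (n := 1) q₀).continuousOn_tangentMapWithin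
    le_rfl hU.uniqueMDiffOn
  refine ContinuousAt.comp' (hc.continuousAt ?_)
    ((tangentBundleModelSpaceHomeomorph _).symm.continuous.continuousAt.comp'
      ((continuousAt_lineMap_extChartAt q₀ s).prodMk (h2.sub h1)))
  refine (hU.preimage (FiberBundle.continuous_proj _ _)).mem_nhds ?_
  change AffineMap.lineMap (extChartAt (𝓡 d) q₀ q₀) (extChartAt (𝓡 d) q₀ q₀) s ∈
    (extChartAt (𝓡 d) q₀).target
  rw [AffineMap.lineMap_same_apply]
  exact mem_extChartAt_target q₀

/-! ### Timelike segments between nearby points. -/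

/-- The points near `z` and near its translate along a timelike Killing field are joined by timelike
segments. -/
theorem eventually_timelikeArc {S : MechanicalSystem r d T Q} (hS : S.IsAutonomous)
    (hT : (T : Set ℝ).OrdConnected) {z : T × Q × ℝ} {t₁ : T} (ht : (z.1 : ℝ) < t₁) {c : ℝ}
    (hc : -S.V z.1 z.2.1 < c) :
    ∀ᶠ p in 𝓝 (z, ((t₁, z.2.1, z.2.2 + c * (t₁ - z.1)) : T × Q × ℝ)),
      TimelikeArc (spacetimeModel d) S.metric S.timeOrientation p.1 p.2 := by
  obtain ⟨t₀, q₀, y₀⟩ := z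
  dsimp only at ht hc ⊢
  set p₀ : (T × Q × ℝ) × (T × Q × ℝ) := ((t₀, q₀, y₀), (t₁, q₀, y₀ + c * (t₁ - t₀)))
  set e := extChartAt (𝓡 d) q₀ with he
  have hU : IsOpen e.target := isOpen_extChartAt_target (I := 𝓡 d) q₀
  have hpos : ∀ᶠ p : (T × Q × ℝ) × (T × Q × ℝ) in 𝓝 p₀, (p.1.1 : ℝ) < p.2.1 :=
    (isOpen_lt (by fun_prop) (by fun_prop)).mem_nhds ht
  have hs1 : ∀ᶠ p : (T × Q × ℝ) × (T × Q × ℝ) in 𝓝 p₀, p.1.2.1 ∈ e.source :=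
    (by fun_prop : Continuous fun p : (T × Q × ℝ) × (T × Q × ℝ) ↦ p.1.2.1).continuousAt
      (extChartAt_source_mem_nhds (I := 𝓡 d) q₀)
  have hs2 : ∀ᶠ p : (T × Q × ℝ) × (T × Q × ℝ) in 𝓝 p₀, p.2.2.1 ∈ e.source :=
    (by fun_prop : Continuous fun p : (T × Q × ℝ) × (T × Q × ℝ) ↦ p.2.2.1).continuousAt
      (extChartAt_source_mem_nhds (I := 𝓡 d) q₀)
  -- By autonomy the inequality may be tested at the fixed time `t₀`. Compactness of `[0, 1]` makes
  -- the neighbourhood of `p₀` independent of `s`.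
  have hline : ∀ᶠ p : (T × Q × ℝ) × (T × Q × ℝ) in 𝓝 p₀, ∀ s ∈ Icc (0 : ℝ) 1,
      AffineMap.lineMap (e p.1.2.1) (e p.2.2.1) s ∈ e.target ∧
      S.normSq t₀ (segmentVelocity (d := d) q₀ (p.1.2.1, p.2.2.1) s,
        (p.2.1 : ℝ) - p.1.1, p.2.2.2 - p.1.2.2) < 0 := by
    refine isCompact_Icc.eventually_forall_of_forall_eventually fun s _ ↦ ?_
    have hq : ContinuousAt (fun x : ((T × Q × ℝ) × (T × Q × ℝ)) × ℝ ↦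
      ((x.1.1.2.1, x.1.2.2.1), x.2)) (p₀, s) := by fun_prop
    refine Filter.Eventually.and ?_ ?_
    · refine (ContinuousAt.comp_of_eq (continuousAt_lineMap_extChartAt (d := d) q₀ s) hq
        rfl).eventually_mem (hU.mem_nhds ?_)
      simp [p₀, e]
    · refine ContinuousAt.eventually_lt (f := fun x : ((T × Q × ℝ) × (T × Q × ℝ)) × ℝ ↦
        S.normSq t₀ (segmentVelocity (d := d) q₀ (x.1.1.2.1, x.1.2.2.1) x.2,
        (x.1.2.1 : ℝ) - x.1.1.1, x.1.2.2.2 - x.1.1.2.2)) (g := fun _ ↦ 0) ?_ continuousAt_const ?_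
      · refine (S.continuous_normSq t₀).continuousAt.comp'
          ((ContinuousAt.comp_of_eq (continuousAt_segmentVelocity (d := d) q₀ s) hq rfl).prodMk ?_)
        fun_prop
      -- At `p₀` the spatial segment is constant, and the value is `-2 (t₁ - t₀)² (c + V)`.
      · rw [segmentVelocity_self, S.normSq_zero]
        have : 0 < (t₁ - t₀ : ℝ) ^ 2 * (c + S.V t₀ q₀) :=
          mul_pos (pow_pos (sub_pos.2 ht) 2) (by linarith)
        linarith
  filter_upwards [hpos, hs1, hs2, hline] with p hp h1 h2 hl
  obtain ⟨⟨s₀, w, y⟩, ⟨s₁, w', y'⟩⟩ := p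
  dsimp only at hp h1 h2 hl
  have hmem : ∀ s ∈ Icc (0 : ℝ) 1, AffineMap.lineMap (s₀ : ℝ) s₁ s ∈ T := fun s hs ↦
    hT.convex.lineMap_mem s₀.2 s₁.2 hs
  classical
  let t : ℝ → T := fun s ↦ if h : AffineMap.lineMap (s₀ : ℝ) s₁ s ∈ T then ⟨_, h⟩ else s₀
  have ht' : ∀ s ∈ Icc (0 : ℝ) 1, (t s : ℝ) = AffineMap.lineMap (s₀ : ℝ) s₁ s :=
    fun s hs ↦ by simp [t, hmem s hs]
  have hsymm := contMDiffOn_extChartAt_symm (I := 𝓡 d) (n := 1) q₀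
  have hder : ∀ s : ℝ, HasDerivWithinAt (fun s : ℝ ↦ AffineMap.lineMap (e w) (e w') s)
      (e w' - e w) (Icc (0 : ℝ) 1) s := fun s ↦ AffineMap.hasDerivWithinAt_lineMap
  have hcd : ∀ {F : Type} [NormedAddCommGroup F] [NormedSpace ℝ F] (x x' : F),
      ContDiffOn ℝ 1 (fun s : ℝ ↦ AffineMap.lineMap x x' s) (Icc (0 : ℝ) 1) := fun x x' ↦ by
    simp only [AffineMap.lineMap_apply_module]
    fun_prop
  refine (S.timelikeArc_iff _ _).2 ⟨0, 1, t, fun s ↦ e.symm (AffineMap.lineMap (e w) (e w') s),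
    fun s ↦ AffineMap.lineMap y y' s, fun _ ↦ s₁ - s₀,
    fun s ↦ mfderivWithin 𝓘(ℝ, EuclideanSpace ℝ (Fin d)) (𝓡 d) e.symm e.target
      (AffineMap.lineMap (e w) (e w') s) (e w' - e w),
    fun _ ↦ y' - y, zero_lt_one, ?_, ?_, (hcd _ _).congr ht', ?_, hcd _ _, fun s hs ↦ ?_⟩
  · refine Prod.ext (Subtype.ext ?_) ?_
    · simp [ht']
    · simp [e.left_inv h1]
  · refine Prod.ext (Subtype.ext ?_) ?_
    · simp [ht']
    · simp [e.left_inv h2]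
  · exact hsymm.comp (contMDiffOn_iff_contDiffOn.2 (hcd _ _)) fun s hs ↦ (hl s hs).1
  · refine ⟨?_, ?_, ?_, sub_pos.2 hp, ?_⟩
    · exact AffineMap.hasDerivWithinAt_lineMap.congr ht' (ht' s hs)
    · have h3 := ((hsymm _ (hl s hs).1).mdifferentiableWithinAt one_ne_zero).hasMFDerivWithinAt
      have h4 := (hasMFDerivWithinAt_iff_hasFDerivWithinAt.2 (hder s).hasFDerivWithinAt)
      have h5 := h3.comp s h4 fun s hs ↦ (hl s hs).1
      exact (congrArg (HasMFDerivWithinAt 𝓘(ℝ, ℝ) (𝓡 d)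
        (fun s ↦ e.symm (AffineMap.lineMap (e w) (e w') s)) (Icc (0 : ℝ) 1) s)
        (ContinuousLinearMap.ext fun k : ℝ ↦ map_smul (mfderivWithin
          𝓘(ℝ, EuclideanSpace ℝ (Fin d)) (𝓡 d) e.symm e.target
          (AffineMap.lineMap (e w) (e w') s)) k (e w' - e w))).mp h5
    · exact AffineMap.hasDerivWithinAt_lineMap
    · rw [hS.a_eq (t s) t₀, hS.b_eq (t s) t₀, hS.V_eq (t s) t₀]
      exact (hl s hs).2

/-! ### The two reflectivity properties. -/

/-- Past reflectivity: a slight translate of `z` to the future is reachable from `x`, hence `z` is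
reachable from a slight translate of `x` to the past. -/
theorem IsAutonomous.mem_closure_chronPast {S : MechanicalSystem r d T Q} (hS : S.IsAutonomous)
    (hT : (T : Set ℝ).OrdConnected) {x z : T × Q × ℝ}
    (h : z ∈ closure (chronFuture (spacetimeModel d) S.metric S.timeOrientation x)) :
    x ∈ closure (chronPast (spacetimeModel d) S.metric S.timeOrientation z) := by
  -- This makes `∂_t + c ∂_y` timelike at `z`.
  obtain ⟨c, hc⟩ := exists_gt (-S.V z.1 z.2.1)
  -- Times of `T` approaching that of `x` strictly from below; such times exist because `T` is open.
  have hne : (Filter.comap ((↑) : T → ℝ) (𝓝[<] (x.1 : ℝ))).NeBot :=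
    .comap_of_range_mem inferInstance <|
      mem_nhdsWithin_of_mem_nhds (by simpa using! T.isOpen.mem_nhds x.1.2)
  have hle : Filter.comap ((↑) : T → ℝ) (𝓝[<] (x.1 : ℝ)) ≤ 𝓝 x.1 := by
    rw [nhds_subtype]
    exact Filter.comap_mono nhdsWithin_le_nhds
  have hg : ContinuousAt (fun t : T ↦ ((t, x.2.1, x.2.2 + c * (t - x.1)) : T × Q × ℝ)) x.1 := by
    fun_prop
  have hg' := hg.tendsto.mono_left hle
  rw [show ((x.1, x.2.1, x.2.2 + c * (x.1 - x.1)) : T × Q × ℝ) = x by simp] at hg'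
  refine mem_closure_of_tendsto hg' ?_
  have hlt : ∀ᶠ t : T in Filter.comap ((↑) : T → ℝ) (𝓝[<] (x.1 : ℝ)), (t : ℝ) < x.1 :=
    Filter.Eventually.comap self_mem_nhdsWithin _
  -- `z` is shifted forward by `x.1 - t`, the amount by which `x` is shifted back.
  have hmem : ∀ᶠ t : T in 𝓝 x.1, (z.1 + x.1 - t : ℝ) ∈ T :=
    (by fun_prop : ContinuousAt (fun t : T ↦ (z.1 + x.1 - t : ℝ)) x.1).eventually_mem
      (T.isOpen.mem_nhds (by simp))
  filter_upwards [hlt, hle hmem] with t ht htT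
  have harc := eventually_timelikeArc hS hT (t₁ := ⟨_, htT⟩) (z := z)
    (by change (z.1 : ℝ) < z.1 + x.1 - t; linarith) hc
  obtain ⟨w, hw, hxw⟩ := mem_closure_iff_nhds.1 h _
    ((Continuous.prodMk_left _).continuousAt.eventually harc)
  -- Shifting by `t - x.1 < 0` returns the translate of `z` to `z` and moves `x` to the
  -- approximating point at time `t`.
  have := Chronological.translate (t₀ := t) (t₁ := z.1) (σ := t - x.1) (c := c * (t - x.1)) hS hT
    (by ring) (by dsimp only; ring) (Relation.TransGen.tail hxw hw)
  have hz : ((z.1, z.2.1, z.2.2 + c * ((z.1 + x.1 - t : ℝ) - z.1) + c * (t - x.1)) : T × Q × ℝ) =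
      z := Prod.ext rfl (Prod.ext rfl (by ring))
  exact (congrArg (Chronological (spacetimeModel d) S.metric S.timeOrientation _) hz).mp this

/-- Future reflectivity: `z` is reachable from a slight translate of `x` to the past, hence a slight
translate of `z` to the future is reachable from `x`. -/
theorem IsAutonomous.mem_closure_chronFuture {S : MechanicalSystem r d T Q} (hS : S.IsAutonomous)
    (hT : (T : Set ℝ).OrdConnected) {x z : T × Q × ℝ}
    (h : x ∈ closure (chronPast (spacetimeModel d) S.metric S.timeOrientation z)) :
    z ∈ closure (chronFuture (spacetimeModel d) S.metric S.timeOrientation x) := by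
  obtain ⟨c, hc⟩ := exists_gt (-S.V x.1 x.2.1)
  have hne : (Filter.comap ((↑) : T → ℝ) (𝓝[>] (z.1 : ℝ))).NeBot :=
    .comap_of_range_mem inferInstance <|
      mem_nhdsWithin_of_mem_nhds (by simpa using! T.isOpen.mem_nhds z.1.2)
  have hle : Filter.comap ((↑) : T → ℝ) (𝓝[>] (z.1 : ℝ)) ≤ 𝓝 z.1 := by
    rw [nhds_subtype]
    exact Filter.comap_mono nhdsWithin_le_nhds
  have hg : ContinuousAt (fun t : T ↦ ((t, z.2.1, z.2.2 + c * (t - z.1)) : T × Q × ℝ)) z.1 := by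
    fun_prop
  have hg' := hg.tendsto.mono_left hle
  rw [show ((z.1, z.2.1, z.2.2 + c * (z.1 - z.1)) : T × Q × ℝ) = z by simp] at hg'
  refine mem_closure_of_tendsto hg' ?_
  have hlt : ∀ᶠ t : T in Filter.comap ((↑) : T → ℝ) (𝓝[>] (z.1 : ℝ)), (z.1 : ℝ) < t :=
    Filter.Eventually.comap self_mem_nhdsWithin _
  have hmem : ∀ᶠ t : T in 𝓝 z.1, (x.1 + z.1 - t : ℝ) ∈ T :=
    (by fun_prop : ContinuousAt (fun t : T ↦ (x.1 + z.1 - t : ℝ)) z.1).eventually_mem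
      (T.isOpen.mem_nhds (by simp))
  filter_upwards [hlt, hle hmem] with t ht htT
  set t' : T := ⟨_, htT⟩ with ht'
  have htv : (t' : ℝ) = x.1 + z.1 - t := rfl
  -- The base point is now the past translate of `x`, with `x` itself as the future endpoint; the
  -- condition on `c` transfers because `V` is the same at both times.
  have harc := eventually_timelikeArc hS hT (t₁ := x.1)
    (z := (t', x.2.1, x.2.2 + c * (t' - x.1))) (by dsimp only; linarith)
    (c := c) (by rwa [hS.V_eq _ x.1])
  rw [show ((x.1, x.2.1, x.2.2 + c * (t' - x.1) + c * (x.1 - t')) : T × Q × ℝ) = x from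
    Prod.ext rfl (Prod.ext rfl (by ring))] at harc
  obtain ⟨w, hw, hwz⟩ := mem_closure_iff_nhds.1 h _
    ((Continuous.prodMk_right _).continuousAt.eventually harc)
  have := Chronological.translate (t₀ := x.1) (t₁ := t) (σ := t - z.1) (c := c * (t - z.1)) hS hT
    (by rw [htv]; ring) (by ring) (Relation.TransGen.head hw hwz)
  have hx : ((x.1, x.2.1, x.2.2 + c * (t' - x.1) + c * (t - z.1)) : T × Q × ℝ) = x :=
    Prod.ext rfl (Prod.ext rfl (by rw [htv]; ring))
  exact (congrArg (Chronological (spacetimeModel d) S.metric S.timeOrientation · _) hx).mp this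

end MechanicalSystem

theorem theorem4p10 (r : ℕ∞ω) (hr : 2 ≤ r) (d : ℕ)
    (T : TopologicalSpace.Opens ℝ) (hT : IsConnected (T : Set ℝ))
    (Q : Type*) [TopologicalSpace Q] [T2Space Q] [ParacompactSpace Q] [ConnectedSpace Q]
    [ChartedSpace (EuclideanSpace ℝ (Fin d)) Q]
    [IsManifold (𝓡 d) 1 Q] [IsManifold (𝓡 d) (r + 1) Q]
    (S : MechanicalSystem r d T Q) (hS : S.IsAutonomous) :
    Reflective (spacetimeModel d) S.metric S.timeOrientation := by
  have hO : (T : Set ℝ).OrdConnected := hT.isPreconnected.ordConnected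
  exact ⟨fun x z hz ↦ hS.mem_closure_chronPast hO hz, fun x z hx ↦ hS.mem_closure_chronFuture hO hx⟩
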